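/- Setting. A network on $N\ge 1$ nodes is a matrix $[a_{ij}]\in\mathbb R^{N\times N}$ with $a_{ij}\ge 0$, $a_{ii}=0$; there is an edge from $j$ to $i$ iff $a_{ij}>0$. Its Laplacian $L$ has entries $\ell_{ii}=\sum_l a_{il}$ and $\ell_{ij}=-a_{ij}$ for $i\neq j$. A bicomponent is a maximal strongly connected subgraph; it is basic if it has no incoming edges. A directed spanning tree is a subgraph containing all nodes in which one node, the root, has no parent, every other node has exactly one parent, and every node is reached from the root. Local bounds are numbers $q_i\ge\sum_j a_{ij}$. They define the row-stochastic matrix $D$ by $d_{ij}=a_{ij}/(1+q_i)$ for $i\ne j$ and $d_{ii}=1-\sum_{j\ne i}d_{ij}$. The agents $$x_i(t+1)=Ax_i(t)+Bu_i(t),\qquad y_i(t)=Cx_i(t),\qquad x_i(t)\in\mathbb R^n,\ u_i(t),y_i(t)\in\mathbb R,$$ exchange $\zeta_i=\sum_{j\ne i}d_{ij}(y_i-y_j)$ and use the protocol $$x_{i,c}(t+1)=A_cx_{i,c}(t)+B_c\zeta_i(t),\qquad u_i(t)=F_cx_{i,c}(t)+G_c\zeta_i(t),\qquad x_{i,c}(t)\in\mathbb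 R^{n_c}.$$ The protocol solves the scale-free non-collaborative state synchronization problem if $x_i(t)-x_j(t)\to 0$ as $t\to\infty$ for all $i,j$, for every number of agents, every network containing a directed spanning tree, all local bounds $q_i$ and all initial conditions of agents and protocols. Put $\tilde A=\begin{pmatrix}A&BF_c\\0&A_c\end{pmatrix}$. Theorem. Suppose that a network does not contain a directed spanning tree. Then its Laplacian has the eigenvalue $0$ with algebraic multiplicity $k>1$, and the network has exactly $k$ basic bicomponents $\mathcal B_1,\dots,\mathcal B_k$. There are real coefficients $\beta_{j,i}\ge 0$ with $\sum_{i=1}^k\beta_{j,i}=1$ ($j$ any node outside all basic bicomponents, $1\le i\le k$), which depend only on the network, such that the following holds for all agents and every protocol that solves the scale-free problem above, all local bounds $q_i$, and all initial conditions. There are trajectories $x_{i,s}$, $x_{i,s,c}$ ($1\le i\le k$) with $$\begin{pmatrix}x_{i,s}(t+1)\\x_{i,s,c}(t+1)\end{pmatrix}=\tilde A\begin{pmatrix}x_{i,s}(t)\\x_{i,s,c}(t)\end{pmatrix},$$ whose initial condition is a linear combination of the initial conditions $\begin{pmatrix}x_j(0)\\x_{j,c}(0)\end{pmatrix}$, $j\in\mathcal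 B_i$, with coefficients that depend only on the network and the $q_i$, such that, as $t\to\infty$: - $x_j(t)-x_{i,s}(t)\to 0$ for every $j\in\mathcal B_i$; - $x_j(t)-\sum_{i=1}^k\beta_{j,i}x_{i,s}(t)\to 0$ for every $j$ outside all basic bicomponents; - if the pair $(BF_c,A_c)$ is detectable (every solution of $w(t+1)=A_cw(t)$ with $BF_cw(t)=0$ for all $t$ converges to $0$), then also $x_{j,c}(t)-x_{i,s,c}(t)\to 0$ for every $j\in\mathcal B_i$, and $x_{j,c}(t)-\sum_{i=1}^k\beta_{j,i}x_{i,s,c}(t)\to 0$ for every $j$ outside all basic bicomponents. -/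

import Mathlib

open Filter Topology

noncomputable section

namespace ScaleFree

/-- A weighted directed communication network on the nodes `Fin N`. The entry `a i j` is the
weight of the edge from node `j` to node `i` (zero when there is no such edge). -/
structure Network (N : ℕ) where
  a : Matrix (Fin N) (Fin N) ℝ
  nonneg : ∀ i j, 0 ≤ a i j
  no_loop : ∀ i, a i i = 0

namespace Network

variable {N : ℕ} (G : Network N)

/-- There is an edge from node `j` to node `i`. -/
def Edge (j i : Fin N) : Prop := 0 < G.a i j

/-- Weighted in-degree of a node. -/
def inDegree (i : Fin N) : ℝ := ∑ j, G.a i j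

/-- The Laplacian matrix. -/
def laplacian : Matrix (Fin N) (Fin N) ℝ :=
  Matrix.of fun i j => if i = j then ∑ l, G.a i l else - G.a i j

/-- The network contains a directed spanning tree: a set `T` of edges of the network and a root
`r` such that `r` has no parent in `T`, every other node has exactly one parent in `T`, and
every node is reached from `r` along edges of `T`. -/
def HasSpanningTree : Prop :=
  ∃ (T : Fin N → Fin N → Prop) (r : Fin N),
    (∀ u v, T u v → G.Edge u v) ∧ (∀ u, ¬ T u r) ∧ (∀ v, v ≠ r → ∃! u, T u v) ∧
      ∀ v, Relation.ReflTransGen T r v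

/-- The subgraph induced on the (nonempty) node set `S` is strongly connected: any two nodes of
`S` are joined by a directed path that stays in `S`. -/
def StronglyConnectedOn (S : Finset (Fin N)) : Prop :=
  S.Nonempty ∧ ∀ u ∈ S, ∀ v ∈ S,
    Relation.ReflTransGen (fun x y => x ∈ S ∧ y ∈ S ∧ G.Edge x y) u v

/-- A bicomponent: a strongly connected subgraph which is maximal by inclusion. -/
def IsBicomponent (S : Finset (Fin N)) : Prop := Maximal G.StronglyConnectedOn S

/-- A basic bicomponent: a bicomponent without incoming edges. -/
def IsBasicBicomponent (S : Finset (Fin N)) : Prop :=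
  G.IsBicomponent S ∧ ∀ u, u ∉ S → ∀ v ∈ S, ¬ G.Edge u v

open Classical in
/-- The finite set of all basic bicomponents. -/
def basicBicomponents : Finset (Finset (Fin N)) :=
  Finset.univ.filter fun S => G.IsBasicBicomponent S

/-- `q i` is an upper bound on the in-degree of node `i`, for every node `i`. -/
def IsLocalBound (q : Fin N → ℝ) : Prop := ∀ i, G.inDegree i ≤ q i

/-- The row stochastic matrix `D` built from the local bounds `q`. -/
def rowStochastic (q : Fin N → ℝ) : Matrix (Fin N) (Fin N) ℝ :=
  Matrix.of fun i j =>
    if i = j then 1 - ∑ l ∈ Finset.univ.erase i, G.a i l / (1 + q i)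
    else G.a i j / (1 + q i)

end Network

/-- Single-input single-output agent model `x⁺ = A x + B u`, `y = C x` with `n` states. -/
structure Agent (n : ℕ) where
  A : Matrix (Fin n) (Fin n) ℝ
  B : Matrix (Fin n) (Fin 1) ℝ
  C : Matrix (Fin 1) (Fin n) ℝ

/-- Linear non-collaborative protocol `x_c⁺ = A_c x_c + B_c ζ`, `u = F_c x_c + G_c ζ`
with `m` states. -/
structure Protocol (m : ℕ) where
  Ac : Matrix (Fin m) (Fin m) ℝ
  Bc : Matrix (Fin m) (Fin 1) ℝ
  Fc : Matrix (Fin 1) (Fin m) ℝ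
  Gc : Matrix (Fin 1) (Fin 1) ℝ

/-- The matrix `Ã = [A, B F_c; 0, A_c]`. -/
def tildeA {n m : ℕ} (M : Agent n) (P : Protocol m) : Matrix (Fin n ⊕ Fin m) (Fin n ⊕ Fin m) ℝ :=
  Matrix.fromBlocks M.A (M.B * P.Fc) 0 P.Ac

/-- The information `ζ_i = ∑_{j ≠ i} d_{ij} (y_i - y_j)` available to agent `i` when the agent
states are `x`. -/
def zeta {N n : ℕ} (G : Network N) (q : Fin N → ℝ) (M : Agent n) (x : Fin N → Fin n → ℝ)
    (i : Fin N) : Fin 1 → ℝ :=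
  ∑ j ∈ Finset.univ.erase i, G.rowStochastic q i j • (M.C.mulVec (x i) - M.C.mulVec (x j))

/-- `x t i` and `xc t i` are the states at time `t` of agent `i` and of its protocol, in the
discrete-time closed loop on the network `G` with local bounds `q`. -/
def IsClosedLoop {N n m : ℕ} (G : Network N) (q : Fin N → ℝ) (M : Agent n) (P : Protocol m)
    (x : ℕ → Fin N → Fin n → ℝ) (xc : ℕ → Fin N → Fin m → ℝ) : Prop :=
  ∀ t i,
    x (t + 1) i = M.A.mulVec (x t i)
      + M.B.mulVec (P.Fc.mulVec (xc t i) + P.Gc.mulVec (zeta G q M (x t) i)) ∧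
    xc (t + 1) i = P.Ac.mulVec (xc t i) + P.Bc.mulVec (zeta G q M (x t) i)

/-- The protocol solves the discrete-time scale-free non-collaborative state synchronization
problem: for any number of agents, any network containing a directed spanning tree, any local
bounds and any initial conditions, the agent states synchronize. -/
def SolvesScaleFree {n m : ℕ} (M : Agent n) (P : Protocol m) : Prop :=
  ∀ (N : ℕ) (G : Network N) (q : Fin N → ℝ), G.HasSpanningTree → G.IsLocalBound q →
    ∀ (x : ℕ → Fin N → Fin n → ℝ) (xc : ℕ → Fin N → Fin m → ℝ), IsClosedLoop G q M P x xc →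
      ∀ i j, Tendsto (fun t => x t i - x t j) atTop (𝓝 0)

/-- Discrete-time detectability of the pair `(H, F)`: every solution of `w(t+1) = F w(t)` whose
output `H w(t)` vanishes identically converges to zero. -/
def Detectable {m p : ℕ} (H : Matrix (Fin p) (Fin m) ℝ) (F : Matrix (Fin m) (Fin m) ℝ) : Prop :=
  ∀ w : ℕ → Fin m → ℝ, (∀ t, w (t + 1) = F.mulVec (w t)) → (∀ t, H.mulVec (w t) = 0) →
    Tendsto w atTop (𝓝 0)

end ScaleFree

end

/-!
The proof compares the given network with networks that do contain a directed spanning tree, and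
never computes an eigenvalue.

*Network side.* The set of ancestors of a node with fewest ancestors is a basic bicomponent, so
every node is reached from a basic bicomponent (`exists_basicBicomponent_reaches`). The maximum
principle for the Laplacian `L` then says that a function harmonic outside the basic bicomponents is
determined by its values on them, and the Dirichlet problem is solvable. The harmonic measures
`β · S`, equal to one on `S` and to zero on the other basic bicomponents, form a basis of the kernel
of `L` (`finrank_ker_laplacian`); since also `ker L² = ker L`, the algebraic multiplicity of zero is
the number of basic bicomponents.

*Dynamics.* In a basic bicomponent `S` the agents are not influenced from outside. Rewiring the other
nodes so that they listen to one node of `S` gives a network with a spanning tree, and the agents of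
`S` synchronize. A left null vector `α` of the rows of `I - D` in `S` turns their joint states `ξ_j`
into a trajectory `Ξ_S = ∑ α_j ξ_j` of `Ã`, whose agent part the agents of `S` approach. As
`L β = 0`, the deviations `δ_j = ξ_j - ∑_S β_{j,S} Ξ_S` solve the same closed loop, and their agent
parts vanish in the limit on the basic bicomponents. Replacing `δ_j` by zero at these nodes leaves,
up to a vanishing disturbance, a trajectory on the network in which the basic bicomponents are replaced by a
root at rest; that network has a spanning tree, so all agent parts of `δ` tend to zero
(`SolvesScaleFree.tendsto_of_tendsto_basic`).

*Stability.* Two facts about finite-dimensional linear systems absorb the disturbances: a system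
whose output decays along all free trajectories has a summable impulse response, hence a decaying
output under each decaying input (`tendsto_output_of_tendsto_input`), and detectability in terms of
unobservable trajectories implies decay of the state whenever input and output decay
(`tendsto_of_detectable`). The latter gives the claim about the protocol states.
-/

namespace ScaleFree

/-! ### Stability of finite-dimensional linear systems -/

section Stability

variable {V W Y : Type*} [NormedAddCommGroup V] [NormedSpace ℝ V] [FiniteDimensional ℝ V]
  [NormedAddCommGroup W] [NormedSpace ℝ W] [FiniteDimensional ℝ W]
  [NormedAddCommGroup Y] [NormedSpace ℝ Y] [FiniteDimensional ℝ Y]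

/-- On a finite-dimensional space, pointwise convergence of linear maps is norm convergence. -/
theorem tendsto_clm_of_pointwise {f : ℕ → W →L[ℝ] Y}
    (h : ∀ w, Tendsto (fun t => f t w) atTop (𝓝 0)) : Tendsto f atTop (𝓝 0) := by
  let ev : (W →L[ℝ] Y) →ₗ[ℝ] (W → Y) :=
    { toFun := fun g w => g w
      map_add' := fun _ _ => rfl
      map_smul' := fun _ _ => rfl }
  have hev : LinearMap.ker ev = ⊥ := by
    refine LinearMap.ker_eq_bot.2 fun a b hab => ?_
    ext w
    exact congrFun hab w
  rw [(LinearMap.isClosedEmbedding_of_injective hev).isInducing.tendsto_nhds_iff, map_zero]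
  exact tendsto_pi_nhds.2 h

/-- If the powers of a linear map on a finite-dimensional space tend to zero pointwise, their
norms are summable. -/
theorem summable_norm_pow_of_tendsto {R : W →L[ℝ] W}
    (h : ∀ w, Tendsto (fun t : ℕ => (R ^ t) w) atTop (𝓝 0)) : Summable fun t : ℕ => ‖R ^ t‖ := by
  have h0 : Tendsto (fun t : ℕ => ‖R ^ t‖) atTop (𝓝 0) :=
    tendsto_zero_iff_norm_tendsto_zero.1 (tendsto_clm_of_pointwise h)
  obtain ⟨T, hT, hT0⟩ := ((h0.eventually (gt_mem_nhds one_pos)).and (eventually_gt_atTop 0)).exists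
  have : NeZero T := ⟨hT0.ne'⟩
  -- write `t = q * T + r` with `r < T`
  rw [← (Nat.divModEquiv T).symm.summable_iff]
  have hprod := Summable.mul_of_nonneg (summable_geometric_of_lt_one (norm_nonneg _) hT)
    (Summable.of_finite (f := fun r : Fin T => ‖R ^ (r : ℕ)‖))
    (fun _ => by positivity) (fun _ => norm_nonneg _)
  refine Summable.of_nonneg_of_le (fun _ => norm_nonneg _) (fun p => ?_) hprod
  obtain ⟨a, r⟩ := p
  simp only [Function.comp_apply, Nat.divModEquiv_symm_apply]
  rcases Nat.eq_zero_or_pos a with rfl | ha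
  · simp
  · rw [Nat.mul_comm a T, pow_add, pow_mul]
    exact (norm_mul_le _ _).trans
      (mul_le_mul_of_nonneg_right (norm_pow_le' _ ha) (norm_nonneg _))

/-- If a single orbit of a linear map `Φ` tends to zero, its norms are summable: all orbits in the
cyclic subspace that it spans tend to zero. -/
theorem summable_norm_orbit {Φ : W →ₗ[ℝ] W} {x : W}
    (h : Tendsto (fun t : ℕ => (Φ ^ t) x) atTop (𝓝 0)) : Summable fun t : ℕ => ‖(Φ ^ t) x‖ := by
  let U : Submodule ℝ W := Submodule.span ℝ (Set.range fun t : ℕ => (Φ ^ t) x)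
  have hU : ∀ w ∈ U, Φ w ∈ U := by
    intro w hw
    refine (Submodule.span_le (p := U.comap Φ)).2 ?_ hw
    rintro _ ⟨t, rfl⟩
    refine Submodule.subset_span ⟨t + 1, ?_⟩
    change (Φ ^ (t + 1)) x = _
    rw [pow_succ', Module.End.mul_apply]
  let R : U →L[ℝ] U := LinearMap.toContinuousLinearMap (Φ.restrict hU)
  have hRpow : ∀ (t : ℕ) (w : U), (((R ^ t) w : U) : W) = (Φ ^ t) w := by
    intro t
    induction t with
    | zero => intro w; rfl
    | succ t ih =>
      intro w
      rw [pow_succ, mul_apply_eq_comp, ih, pow_succ, Module.End.mul_apply]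
      rfl
  have hR : ∀ w : U, Tendsto (fun t : ℕ => (R ^ t) w) atTop (𝓝 0) := by
    rintro ⟨w, hw⟩
    rw [Topology.IsInducing.subtypeVal.tendsto_nhds_iff]
    simp only [Function.comp_def, hRpow]
    induction hw using Submodule.span_induction with
    | mem w hw =>
      obtain ⟨s, rfl⟩ := hw
      refine (h.comp (tendsto_add_atTop_nat s)).congr fun t => ?_
      simp only [Function.comp_apply]
      rw [pow_add, Module.End.mul_apply]
    | zero => simp
    | add w₁ w₂ _ _ h₁ h₂ => simpa only [map_add, add_zero, Submodule.coe_zero] using h₁.add h₂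
    | smul c w _ h₁ => simpa only [map_smul, smul_zero, Submodule.coe_zero] using h₁.const_smul c
  have hx : x ∈ U := Submodule.subset_span ⟨0, rfl⟩
  refine Summable.of_nonneg_of_le (fun _ => norm_nonneg _) (fun t => ?_)
    ((summable_norm_pow_of_tendsto hR).mul_right ‖(⟨x, hx⟩ : U)‖)
  rw [← hRpow t ⟨x, hx⟩]
  exact (R ^ t).le_opNorm ⟨x, hx⟩

/-- If the output `H` of the linear system `v⁺ = K v` tends to zero along every trajectory, then
the norms of its impulse response `H K ^ t` are summable. Modes of `K` that `H` does not see need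
not decay: the argument is about the orbit of `H` under precomposition with `K`. -/
theorem summable_norm_output {K : V →L[ℝ] V} {H : V →L[ℝ] Y}
    (h : ∀ v, Tendsto (fun t : ℕ => H ((K ^ t) v)) atTop (𝓝 0)) :
    Summable fun t : ℕ => ‖H ∘L (K ^ t)‖ := by
  let Φ : (V →L[ℝ] Y) →ₗ[ℝ] (V →L[ℝ] Y) :=
    { toFun := fun g => g ∘L K
      map_add' := fun _ _ => rfl
      map_smul' := fun _ _ => rfl }
  have hΦ : ∀ t : ℕ, (Φ ^ t) H = H ∘L (K ^ t) := by
    intro t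
    induction t with
    | zero => rfl
    | succ t ih =>
      rw [pow_succ', Module.End.mul_apply, ih, pow_succ]
      rfl
  have := summable_norm_orbit (Φ := Φ) (x := H) (by
    simp only [hΦ]
    exact tendsto_clm_of_pointwise h)
  simpa only [hΦ] using this

/-- A linear system whose output tends to zero along all free trajectories still has an output
tending to zero when it is driven by an input that tends to zero. -/
theorem tendsto_output_of_tendsto_input {K : V →L[ℝ] V} {H : V →L[ℝ] Y}
    (h : ∀ v, Tendsto (fun t : ℕ => H ((K ^ t) v)) atTop (𝓝 0)) {v e : ℕ → V}
    (hv : ∀ t, v (t + 1) = K (v t) + e t) (he : Tendsto e atTop (𝓝 0)) :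
    Tendsto (fun t => H (v t)) atTop (𝓝 0) := by
  have hsol : ∀ t, v t = (K ^ t) (v 0) + ∑ s ∈ Finset.range t, (K ^ s) (e (t - 1 - s)) := by
    intro t
    induction t with
    | zero => simp
    | succ t ih =>
      rw [hv, Finset.sum_range_succ', ih, map_add, map_sum, pow_succ']
      simp only [mul_apply_eq_comp, pow_succ', pow_zero, Nat.add_sub_cancel,
        Nat.sub_zero, one_apply_eq_self, add_assoc]
      congr 2
      exact Finset.sum_congr rfl fun s _ => by rw [Nat.sub_sub, add_comm 1 s]
  let f : ℕ → ℕ → Y := fun t s => if s < t then H ((K ^ s) (e (t - 1 - s))) else 0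
  have hf : ∀ t, ∑' s, f t s = ∑ s ∈ Finset.range t, H ((K ^ s) (e (t - 1 - s))) := by
    intro t
    rw [tsum_eq_sum (s := Finset.range t)]
    · exact Finset.sum_congr rfl fun s hs => if_pos (Finset.mem_range.1 hs)
    · exact fun s hs => if_neg fun h' => hs (Finset.mem_range.2 h')
  obtain ⟨C, hC⟩ := he.norm.bddAbove_range
  have hC' : ∀ t, ‖e t‖ ≤ C := fun t => hC ⟨t, rfl⟩
  have hC0 : 0 ≤ C := (norm_nonneg _).trans (hC' 0)
  have hlim : Tendsto (fun t => ∑' s, f t s) atTop (𝓝 (∑' _ : ℕ, (0 : Y))) := by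
    refine tendsto_tsum_of_dominated_convergence ((summable_norm_output h).mul_right C) ?_ ?_
    · intro s
      have h1 : Tendsto (fun t => (H ∘L (K ^ s)) (e (t - 1 - s))) atTop (𝓝 0) := by
        have h2 : Tendsto (fun t : ℕ => t - 1 - s) atTop atTop := by
          simpa only [Nat.sub_sub] using tendsto_sub_atTop_nat (1 + s)
        have h3 := ((H ∘L (K ^ s)).continuous.tendsto 0).comp (he.comp h2)
        rwa [map_zero] at h3
      refine h1.congr' ?_
      filter_upwards [eventually_gt_atTop s] with t ht
      exact (if_pos ht).symm
    · refine Eventually.of_forall fun t s => ?_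
      by_cases hst : s < t
      · simp only [f, hst, if_true]
        exact ((H ∘L (K ^ s)).le_opNorm _).trans
          (mul_le_mul_of_nonneg_left (hC' _) (norm_nonneg _))
      · simp only [f, hst, if_false, norm_zero]
        positivity
  rw [tsum_zero] at hlim
  have := (h (v 0)).add hlim
  rw [add_zero] at this
  refine this.congr fun t => ?_
  rw [hf, ← map_sum, ← map_add, ← hsol]

/-- A sequence along which every output `H (K ^ s v)` tends to zero tends to zero modulo the
unobservable subspace: its image tends to zero under each linear map that kills this subspace. -/
theorem tendsto_of_tendsto_outputs {V W Y : Type*} [NormedAddCommGroup V] [NormedSpace ℝ V]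
    [FiniteDimensional ℝ V] [NormedAddCommGroup W] [NormedSpace ℝ W] [NormedAddCommGroup Y]
    [NormedSpace ℝ Y] {K : V →ₗ[ℝ] V} {H : V →ₗ[ℝ] Y} {g : V →ₗ[ℝ] W}
    (hg : ∀ v, (∀ s : ℕ, H ((K ^ s) v) = 0) → g v = 0) {w : ℕ → V}
    (hw : ∀ s : ℕ, Tendsto (fun t => H ((K ^ s) (w t))) atTop (𝓝 0)) :
    Tendsto (fun t => g (w t)) atTop (𝓝 0) := by
  -- The observation map has finite-dimensional range in the product space `ℕ → Y`, so that `g`,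
  -- which factors through it, is a continuous function of the observations.
  let O : V →ₗ[ℝ] (ℕ → Y) := LinearMap.pi fun s => H ∘ₗ (K ^ s)
  have hker : LinearMap.ker O ≤ LinearMap.ker g := fun v hv =>
    hg v fun s => congrFun (LinearMap.mem_ker.1 hv) s
  let g' : LinearMap.range O →ₗ[ℝ] W :=
    (LinearMap.ker O).liftQ g hker ∘ₗ O.quotKerEquivRange.symm.toLinearMap
  have hg' : ∀ v, g' (O.rangeRestrict v) = g v := by
    intro v
    have : O.quotKerEquivRange.symm (O.rangeRestrict v) = Submodule.Quotient.mk v := by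
      rw [LinearEquiv.symm_apply_eq]
      rfl
    change (LinearMap.ker O).liftQ g hker (O.quotKerEquivRange.symm (O.rangeRestrict v)) = g v
    rw [this]
    rfl
  have hcont : Continuous g' := g'.continuous_of_finiteDimensional
  have hO : Tendsto (fun t => O.rangeRestrict (w t)) atTop (𝓝 0) := by
    rw [Topology.IsInducing.subtypeVal.tendsto_nhds_iff]
    exact tendsto_pi_nhds.2 hw
  have := (hcont.tendsto 0).comp hO
  rw [map_zero] at this
  exact this.congr fun t => hg' (w t)

/-- Detectability persists under vanishing perturbations: if the unobservable trajectories of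
`w⁺ = K w` tend to zero, then so does each trajectory driven by an input tending to zero whose
output tends to zero. -/
theorem tendsto_of_detectable {V Y : Type*} [NormedAddCommGroup V] [NormedSpace ℝ V]
    [FiniteDimensional ℝ V] [NormedAddCommGroup Y] [NormedSpace ℝ Y] {K : V →ₗ[ℝ] V} {H : V →ₗ[ℝ] Y}
    (hdet : ∀ v, (∀ s : ℕ, H ((K ^ s) v) = 0) → Tendsto (fun t : ℕ => (K ^ t) v) atTop (𝓝 0))
    {w e : ℕ → V} (hw : ∀ t, w (t + 1) = K (w t) + e t) (he : Tendsto e atTop (𝓝 0))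
    (hH : Tendsto (fun t => H (w t)) atTop (𝓝 0)) : Tendsto w atTop (𝓝 0) := by
  -- `U` is the unobservable subspace and `π` a projection onto it
  let U : Submodule ℝ V := ⨅ s : ℕ, LinearMap.ker (H ∘ₗ (K ^ s))
  have hU : ∀ v, v ∈ U ↔ ∀ s : ℕ, H ((K ^ s) v) = 0 := fun v => by simp [U, Submodule.mem_iInf]
  have hKU : ∀ v ∈ U, K v ∈ U := by
    intro v hv
    rw [hU] at hv ⊢
    intro s
    have := hv (s + 1)
    rwa [pow_succ, Module.End.mul_apply] at this
  obtain ⟨π, hπ⟩ := LinearMap.exists_leftInverse_of_injective U.subtype U.ker_subtype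
  have hπU : ∀ u : U, π u = u := fun u => LinearMap.congr_fun hπ u
  have hobs : ∀ s : ℕ, Tendsto (fun t => H ((K ^ s) (w t))) atTop (𝓝 0) := by
    intro s
    induction s with
    | zero => simpa using hH
    | succ s ih =>
      have h1 := ih.comp (tendsto_add_atTop_nat 1)
      have hc : Continuous (H ∘ₗ (K ^ s)) := LinearMap.continuous_of_finiteDimensional _
      have h2 := (hc.tendsto 0).comp he
      rw [map_zero] at h2
      have h3 := h1.sub h2
      rw [sub_zero] at h3
      refine h3.congr fun t => ?_
      simp [hw, pow_succ]
  let c : V →ₗ[ℝ] V := LinearMap.id - U.subtype ∘ₗ π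
  have hc0 : Tendsto (fun t => c (w t)) atTop (𝓝 0) := by
    refine tendsto_of_tendsto_outputs (K := K) (H := H) (fun v hv => ?_) hobs
    have := hπU ⟨v, (hU v).2 hv⟩
    simp only at this
    simp [c, this]
  let KU : U →L[ℝ] U := LinearMap.toContinuousLinearMap (K.restrict hKU)
  have hKUpow : ∀ (t : ℕ) (u : U), (((KU ^ t) u : U) : V) = (K ^ t) u := by
    intro t
    induction t with
    | zero => intro u; simp
    | succ t ih =>
      intro u
      rw [pow_succ, mul_apply_eq_comp, ih, pow_succ, Module.End.mul_apply]
      rfl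
  have hrec : ∀ t, π (w (t + 1)) = KU (π (w t)) + π (K (c (w t)) + e t) := by
    intro t
    have h1 : w t = (π (w t) : V) + c (w t) := by simp [c]
    have h2 : K (w t) = (KU (π (w t)) : V) + K (c (w t)) := by
      conv_lhs => rw [h1, map_add]
      rfl
    rw [hw, h2, add_assoc, map_add, hπU]
  have hin : Tendsto (fun t => π (K (c (w t)) + e t)) atTop (𝓝 0) := by
    have h1 : Continuous K := K.continuous_of_finiteDimensional
    have h2 : Continuous π := π.continuous_of_finiteDimensional
    have h3 := (h1.tendsto 0).comp hc0
    rw [map_zero] at h3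
    have h4 := (h2.tendsto 0).comp (by simpa using h3.add he)
    rw [map_zero] at h4
    exact h4
  have hπw : Tendsto (fun t => π (w t)) atTop (𝓝 0) := by
    refine tendsto_output_of_tendsto_input (K := KU) (H := ContinuousLinearMap.id ℝ U)
      (fun u => ?_) hrec hin
    rw [Topology.IsInducing.subtypeVal.tendsto_nhds_iff]
    exact (hdet u ((hU u).1 u.2)).congr fun t => (hKUpow t u).symm
  have h5 := ((continuous_subtype_val.tendsto (0 : U)).comp hπw).add hc0
  rw [Submodule.coe_zero, add_zero] at h5
  refine h5.congr fun t => ?_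
  simp [c]

end Stability

namespace Network

variable {N : ℕ} (G : Network N)

/-! ### Reachability, spanning trees and basic bicomponents -/

/-- `G.Reaches u v`: there is a directed path from `u` to `v`. -/
def Reaches (u v : Fin N) : Prop := Relation.ReflTransGen G.Edge u v

variable {G}

/-- A network in which one node reaches all the others contains a directed spanning tree, made of
a parent for each node that is one step closer to the root. -/
theorem hasSpanningTree_of_reaches {r : Fin N} (hr : ∀ v, G.Reaches r v) : G.HasSpanningTree := by
  classical
  -- `path k v`: there is a path with `k` edges from `r` to `v`
  let path : ℕ → Fin N → Prop := fun k =>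
    Nat.rec (motive := fun _ => Fin N → Prop) (fun v => v = r) (fun _ p v => ∃ u, p u ∧ G.Edge u v) k
  have hpath : ∀ v, ∃ k, path k v := by
    intro v
    induction hr v with
    | refl => exact ⟨0, rfl⟩
    | tail _ hbc ih =>
      obtain ⟨k, hk⟩ := ih
      exact ⟨k + 1, _, hk, hbc⟩
  let d : Fin N → ℕ := fun v => Nat.find (hpath v)
  have hpar : ∀ v, ∃ u, v ≠ r → G.Edge u v ∧ d u < d v := by
    intro v
    by_cases hv : v = r
    · exact ⟨v, fun h => absurd hv h⟩
    have hdv : path (d v) v := Nat.find_spec (hpath v)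
    rcases hk : d v with _ | k
    · rw [hk] at hdv
      exact absurd hdv hv
    · rw [hk] at hdv
      obtain ⟨u, hu, huv⟩ := hdv
      exact ⟨u, fun _ => ⟨huv, Nat.lt_succ_of_le (Nat.find_min' (hpath u) hu)⟩⟩
  choose p hp using hpar
  refine ⟨fun u v => v ≠ r ∧ u = p v, r, ?_, ?_, ?_, ?_⟩
  · rintro u v ⟨hv, rfl⟩
    exact (hp v hv).1
  · exact fun u hu => hu.1 rfl
  · exact fun v hv => ⟨p v, ⟨hv, rfl⟩, fun u hu => hu.2⟩
  · intro v
    induction hdv : d v using Nat.strong_induction_on generalizing v with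
    | _ k ih =>
      by_cases hv : v = r
      · rw [hv]
      · exact (ih (d (p v)) (hdv ▸ (hp v hv).2) (p v) rfl).tail ⟨hv, rfl⟩

theorem mem_basicBicomponents {S : Finset (Fin N)} :
    S ∈ G.basicBicomponents ↔ G.IsBasicBicomponent S := by
  simp [basicBicomponents]

/-- A set without incoming edges contains all nodes from which it can be reached. -/
theorem mem_of_reaches {S : Finset (Fin N)} (hS : ∀ u, u ∉ S → ∀ v ∈ S, ¬ G.Edge u v)
    {u v : Fin N} (h : G.Reaches u v) (hv : v ∈ S) : u ∈ S := by
  induction h using Relation.ReflTransGen.head_induction_on with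
  | refl => exact hv
  | head huw _ ih => exact by_contra fun hu => hS _ hu _ ih huw

theorem IsBasicBicomponent.nonempty {S : Finset (Fin N)} (hS : G.IsBasicBicomponent S) :
    S.Nonempty := hS.1.1.1

theorem IsBasicBicomponent.reaches {S : Finset (Fin N)} (hS : G.IsBasicBicomponent S)
    {u v : Fin N} (hu : u ∈ S) (hv : v ∈ S) : G.Reaches u v :=
  Relation.ReflTransGen.mono (fun _ _ h => h.2.2) _ _ (hS.1.1.2 u hu v hv)

theorem IsBasicBicomponent.eq_of_mem {S T : Finset (Fin N)} (hS : G.IsBasicBicomponent S)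
    (hT : G.IsBasicBicomponent T) {i : Fin N} (hiS : i ∈ S) (hiT : i ∈ T) : S = T := by
  ext j
  exact ⟨fun hj => mem_of_reaches hT.2 (hS.reaches hj hiS) hiT,
    fun hj => mem_of_reaches hS.2 (hT.reaches hj hiT) hiS⟩

/-- Every node is reached from a basic bicomponent: among the nodes that reach it, one with the
fewest ancestors has an ancestor set that is strongly connected and has no incoming edges. -/
theorem exists_basicBicomponent_reaches (v : Fin N) :
    ∃ S ∈ G.basicBicomponents, ∃ u ∈ S, G.Reaches u v := by
  classical
  let anc : Fin N → Finset (Fin N) := fun u => Finset.univ.filter fun w => G.Reaches w u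
  have hanc : ∀ u w, w ∈ anc u ↔ G.Reaches w u := fun u w => by simp [anc]
  obtain ⟨u, hu, hmin⟩ := (anc v).exists_min_image (fun u => (anc u).card)
    ⟨v, (hanc v v).2 .refl⟩
  rw [hanc] at hu
  have hback : ∀ w ∈ anc u, G.Reaches u w := by
    intro w hw
    have hwu := (hanc u w).1 hw
    have hsub : anc w ⊆ anc u := fun z hz =>
      (hanc u z).2 (((hanc w z).1 hz).trans hwu)
    have heq := Finset.eq_of_subset_of_card_le hsub (hmin w ((hanc v w).2 (hwu.trans hu)))
    exact (hanc w u).1 (heq ▸ (hanc u u).2 .refl)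
  have hclosed : ∀ x, x ∉ anc u → ∀ y ∈ anc u, ¬ G.Edge x y := fun x hx y hy hxy =>
    hx ((hanc u x).2 (.head hxy ((hanc u y).1 hy)))
  refine ⟨anc u, mem_basicBicomponents.2 ⟨⟨⟨⟨u, (hanc u u).2 .refl⟩, ?_⟩, ?_⟩, hclosed⟩, u,
    (hanc u u).2 .refl, hu⟩
  · intro x hx y hy
    have hxy : G.Reaches x y := ((hanc u x).1 hx).trans (hback y hy)
    -- a path that ends in `anc u` never leaves it, since it cannot return
    clear hx
    induction hxy using Relation.ReflTransGen.head_induction_on with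
    | refl => exact .refl
    | head hab hby ih =>
      have hb := mem_of_reaches hclosed hby hy
      exact .head ⟨mem_of_reaches hclosed (.single hab) hb, hb, hab⟩ ih
  · intro T hT hle y hy
    exact (hanc u y).2 (Relation.ReflTransGen.mono (fun _ _ h => h.2.2) _ _
      (hT.2 y hy u (hle ((hanc u u).2 .refl))))

/-- Without a directed spanning tree there are at least two basic bicomponents, since the nodes
of a single one would reach every node. -/
theorem one_lt_card_basicBicomponents (hN : 0 < N) (hG : ¬ G.HasSpanningTree) :
    1 < G.basicBicomponents.card := by
  obtain ⟨S, hS, r, hr, -⟩ := exists_basicBicomponent_reaches (G := G) ⟨0, hN⟩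
  by_contra hcard
  refine hG (hasSpanningTree_of_reaches (r := r) fun v => ?_)
  obtain ⟨T, hT, u, hu, huv⟩ := exists_basicBicomponent_reaches (G := G) v
  obtain rfl := Finset.card_le_one.1 (not_lt.1 hcard) S hS T hT
  exact ((mem_basicBicomponents.1 hS).reaches hr hu).trans huv

/-! ### Harmonic functions and the kernel of the Laplacian -/

theorem laplacian_mulVec (w : Fin N → ℝ) (i : Fin N) :
    G.laplacian.mulVec w i = ∑ j, G.a i j * (w i - w j) := by
  have h : ∀ j, G.laplacian i j * w j
      = (if i = j then (∑ l, G.a i l) * w i else 0) - G.a i j * w j := by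
    intro j
    by_cases hij : i = j
    · subst hij
      simp [laplacian, G.no_loop]
    · simp [laplacian, hij]
  simp only [Matrix.mulVec, dotProduct, h, Finset.sum_sub_distrib, Finset.sum_ite_eq,
    Finset.mem_univ, if_true, mul_sub, Finset.sum_mul]

/-- Local maximum principle: a function that is harmonic at `c` and maximal there among the
in-neighbours of `c` agrees with its value at `c` on these in-neighbours. -/
theorem eq_of_edge_of_le {w : Fin N → ℝ} {c : Fin N} (hc : G.laplacian.mulVec w c = 0)
    (hle : ∀ b, G.Edge b c → w b ≤ w c) {b : Fin N} (hb : G.Edge b c) : w b = w c := by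
  rw [laplacian_mulVec] at hc
  have hnn : ∀ j ∈ Finset.univ, 0 ≤ G.a c j * (w c - w j) := by
    intro j _
    rcases (G.nonneg c j).eq_or_lt with h | h
    · simp [← h]
    · exact mul_nonneg h.le (sub_nonneg.2 (hle j h))
  have h0 := (Finset.sum_eq_zero_iff_of_nonneg hnn).1 hc b (Finset.mem_univ b)
  rcases mul_eq_zero.1 h0 with h | h
  · exact absurd h (ne_of_gt hb)
  · linarith

/-- A function that is harmonic on a basic bicomponent is constant there. -/
theorem eq_of_harmonicOn {S : Finset (Fin N)} (hS : G.IsBasicBicomponent S) {w : Fin N → ℝ}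
    (hw : ∀ i ∈ S, G.laplacian.mulVec w i = 0) {i j : Fin N} (hi : i ∈ S) (hj : j ∈ S) :
    w i = w j := by
  obtain ⟨c, hcS, hmax⟩ := S.exists_max_image w hS.nonempty
  have key : ∀ u, G.Reaches u c → w u = w c := by
    intro u hu
    induction hu using Relation.ReflTransGen.head_induction_on with
    | refl => rfl
    | @head a b hab hbc ih =>
      have hb := mem_of_reaches hS.2 hbc hcS
      rw [← ih]
      refine eq_of_edge_of_le (hw b hb) (fun x hx => ?_) hab
      rw [ih]
      exact hmax x (mem_of_reaches hS.2 (.single hx) hb)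
  rw [key i (hS.reaches hi hcS), key j (hS.reaches hj hcS)]

/-- A node is basic when it lies in a basic bicomponent. -/
def IsBasic (G : Network N) (i : Fin N) : Prop := ∃ S ∈ G.basicBicomponents, i ∈ S

/-- Maximum principle: a function that is harmonic outside the basic bicomponents is bounded by
its maximum on them. -/
theorem le_of_harmonic {w : Fin N → ℝ} (hw : ∀ i, ¬ G.IsBasic i → G.laplacian.mulVec w i = 0)
    {c : ℝ} (hc : ∀ i, G.IsBasic i → w i ≤ c) (i : Fin N) : w i ≤ c := by
  obtain ⟨v, -, hv⟩ := (Finset.univ : Finset (Fin N)).exists_max_image w ⟨i, Finset.mem_univ i⟩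
  obtain ⟨S, hS, u, hu, huv⟩ := exists_basicBicomponent_reaches (G := G) v
  have key : ∀ x, G.Reaches u x → w x = w v → ∃ y, G.IsBasic y ∧ w y = w v := by
    intro x hx
    induction hx with
    | refl => exact fun h => ⟨u, ⟨S, hS, hu⟩, h⟩
    | @tail b c _ hbc ih =>
      intro hcv
      by_cases hcb : G.IsBasic c
      · exact ⟨c, hcb, hcv⟩
      · refine ih ?_
        rw [← hcv]
        exact eq_of_edge_of_le (hw c hcb) (fun x _ => hcv ▸ hv x (Finset.mem_univ x)) hbc
  obtain ⟨y, hy, hyv⟩ := key v huv rfl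
  exact (hv i (Finset.mem_univ i)).trans (hyv ▸ hc y hy)

/-- Minimum principle. -/
theorem ge_of_harmonic {w : Fin N → ℝ} (hw : ∀ i, ¬ G.IsBasic i → G.laplacian.mulVec w i = 0)
    {c : ℝ} (hc : ∀ i, G.IsBasic i → c ≤ w i) (i : Fin N) : c ≤ w i := by
  have := le_of_harmonic (w := -w) (c := -c)
    (fun i hi => by rw [Matrix.mulVec_neg, Pi.neg_apply, hw i hi, neg_zero])
    (fun i hi => neg_le_neg (hc i hi)) i
  simpa using this

theorem eq_zero_of_harmonic {w : Fin N → ℝ}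
    (hw : ∀ i, ¬ G.IsBasic i → G.laplacian.mulVec w i = 0) (hc : ∀ i, G.IsBasic i → w i = 0) :
    w = 0 :=
  funext fun i => le_antisymm (le_of_harmonic hw (fun i hi => (hc i hi).le) i)
    (ge_of_harmonic hw (fun i hi => (hc i hi).ge) i)

/-- Solvability of the Dirichlet problem with boundary values on the basic bicomponents. -/
theorem exists_harmonic (G : Network N) (g : Fin N → ℝ) :
    ∃ w : Fin N → ℝ, (∀ i, ¬ G.IsBasic i → G.laplacian.mulVec w i = 0) ∧
      ∀ i, G.IsBasic i → w i = g i := by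
  classical
  let Φ : (Fin N → ℝ) →ₗ[ℝ] (Fin N → ℝ) := LinearMap.pi fun i =>
    if G.IsBasic i then LinearMap.proj i else LinearMap.proj i ∘ₗ G.laplacian.mulVecLin
  have hΦ : ∀ w i, Φ w i = if G.IsBasic i then w i else G.laplacian.mulVec w i := by
    intro w i
    by_cases hi : G.IsBasic i <;> simp [Φ, hi]
  have hinj : Function.Injective Φ := by
    rw [injective_iff_map_eq_zero]
    intro w hw
    refine eq_zero_of_harmonic (G := G) (fun i hi => ?_) (fun i hi => ?_)
    · simpa [hΦ, hi] using congrFun hw i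
    · simpa [hΦ, hi] using congrFun hw i
  obtain ⟨w, hw⟩ := LinearMap.surjective_of_injective hinj
    (fun i => if G.IsBasic i then g i else 0)
  refine ⟨w, fun i hi => ?_, fun i hi => ?_⟩
  · simpa [hΦ, hi] using congrFun hw i
  · simpa [hΦ, hi] using congrFun hw i

/-- The harmonic measures of the basic bicomponents: `β j S` is the value at `j` of the function
in the kernel of the Laplacian that is one on `S` and zero on the other basic bicomponents. -/
theorem exists_harmonicMeasure (G : Network N) :
    ∃ β : Fin N → Finset (Fin N) → ℝ,
      (∀ S ∈ G.basicBicomponents, G.laplacian.mulVec (fun j => β j S) = 0) ∧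
      (∀ S ∈ G.basicBicomponents, ∀ T ∈ G.basicBicomponents, ∀ j ∈ T,
        β j S = if T = S then 1 else 0) ∧
      (∀ j, ∀ S ∈ G.basicBicomponents, 0 ≤ β j S) ∧
      ∀ j, ∑ S ∈ G.basicBicomponents, β j S = 1 := by
  classical
  choose b hb hb' using fun S : Finset (Fin N) =>
    G.exists_harmonic fun j => if j ∈ S then 1 else 0
  have hval : ∀ S ∈ G.basicBicomponents, ∀ T ∈ G.basicBicomponents, ∀ j ∈ T,
      b S j = if T = S then 1 else 0 := by
    intro S hS T hT j hj
    rw [hb' S j ⟨T, hT, hj⟩]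
    refine if_congr ⟨fun h => ?_, fun h => h ▸ hj⟩ rfl rfl
    exact (mem_basicBicomponents.1 hT).eq_of_mem (mem_basicBicomponents.1 hS) hj h
  refine ⟨fun j S => b S j, fun S hS => funext fun i => ?_, hval, fun j S hS => ?_, fun j => ?_⟩
  · by_cases hi : G.IsBasic i
    · obtain ⟨T, hT, hiT⟩ := hi
      rw [laplacian_mulVec]
      refine Finset.sum_eq_zero fun j _ => ?_
      rcases (G.nonneg i j).eq_or_lt with h | h
      · rw [← h, zero_mul]
      · have hjT := mem_of_reaches (mem_basicBicomponents.1 hT).2 (.single h) hiT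
        have hij : b S i = b S j := by rw [hval S hS T hT i hiT, hval S hS T hT j hjT]
        exact mul_eq_zero_of_right _ (sub_eq_zero.2 hij)
    · exact hb S i hi
  · refine ge_of_harmonic (hb S) (fun i hi => ?_) j
    rw [hb' S i hi]
    split_ifs <;> norm_num
  · -- the sum of the harmonic measures solves the same Dirichlet problem as the constant one
    have h0 := eq_zero_of_harmonic (G := G)
      (w := ∑ S ∈ G.basicBicomponents, b S - fun _ => 1) (fun i hi => ?_) (fun i hi => ?_)
    · have := congrFun h0 j
      simp only [Pi.sub_apply, Finset.sum_apply, Pi.zero_apply] at this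
      linarith
    · have h1 : G.laplacian.mulVec (fun _ => (1 : ℝ)) i = 0 := by simp [laplacian_mulVec]
      rw [Matrix.mulVec_sub, Matrix.mulVec_sum, Pi.sub_apply, Finset.sum_apply, h1, sub_zero]
      exact Finset.sum_eq_zero fun S _ => hb S i hi
    · obtain ⟨T, hT, hiT⟩ := hi
      simp only [Pi.sub_apply, Finset.sum_apply]
      rw [Finset.sum_congr rfl fun S hS => hval S hS T hT i hiT]
      simp [hT]

/-- The harmonic measures form a basis of the kernel of the Laplacian. -/
theorem finrank_ker_laplacian (G : Network N) :
    Module.finrank ℝ (LinearMap.ker G.laplacian.mulVecLin) = G.basicBicomponents.card := by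
  classical
  obtain ⟨β, hβ, hval, -, -⟩ := G.exists_harmonicMeasure
  let f : (G.basicBicomponents → ℝ) →ₗ[ℝ] LinearMap.ker G.laplacian.mulVecLin :=
    Fintype.linearCombination ℝ fun S : G.basicBicomponents =>
      (⟨fun j => β j S, hβ S S.2⟩ : LinearMap.ker G.laplacian.mulVecLin)
  have hf : ∀ c j, (f c : Fin N → ℝ) j = ∑ S, c S * β j S := by
    intro c j
    simp [f, Fintype.linearCombination_apply]
  have hf' : ∀ c, ∀ T : G.basicBicomponents, ∀ j ∈ (T : Finset (Fin N)),
      (f c : Fin N → ℝ) j = c T := by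
    intro c T j hj
    rw [hf, Finset.sum_eq_single T]
    · rw [hval T T.2 T T.2 j hj, if_pos rfl, mul_one]
    · intro S _ hST
      rw [hval S S.2 T T.2 j hj, if_neg (fun h => hST (Subtype.ext h.symm)), mul_zero]
    · simp
  have hne : ∀ S : G.basicBicomponents, (S : Finset (Fin N)).Nonempty :=
    fun S => (mem_basicBicomponents.1 S.2).nonempty
  have hbij : Function.Bijective f := by
    constructor
    · intro c c' hcc
      funext T
      obtain ⟨j, hj⟩ := hne T
      rw [← hf' c T j hj, ← hf' c' T j hj, hcc]
    · rintro ⟨w, hw⟩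
      have hw' : G.laplacian.mulVec w = 0 := hw
      refine ⟨fun T => w (hne T).choose, ?_⟩
      rw [← sub_eq_zero]
      refine Subtype.ext (eq_zero_of_harmonic (G := G) (fun i _ => ?_) (fun i hi => ?_))
      · exact congrFun (f _ - ⟨w, hw⟩ : LinearMap.ker G.laplacian.mulVecLin).2 i
      · obtain ⟨T, hT, hiT⟩ := hi
        have h1 := hf' (fun T => w (hne T).choose) ⟨T, hT⟩ i hiT
        have h2 : w (hne ⟨T, hT⟩).choose = w i :=
          eq_of_harmonicOn (mem_basicBicomponents.1 hT) (fun i _ => congrFun hw' i)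
            (hne ⟨T, hT⟩).choose_spec hiT
        simp only [Submodule.coe_sub, Pi.sub_apply]
        rw [h1, h2, sub_self]
  rw [← (LinearEquiv.ofBijective f hbij).finrank_eq]
  simp

/-- The eigenvalue zero of the Laplacian is semisimple. -/
theorem laplacian_mulVec_eq_zero {w : Fin N → ℝ}
    (hw : G.laplacian.mulVec (G.laplacian.mulVec w) = 0) : G.laplacian.mulVec w = 0 := by
  refine eq_zero_of_harmonic (G := G) (fun i _ => congrFun hw i) ?_
  rintro i ⟨S, hS, hiS⟩
  have hS' := mem_basicBicomponents.1 hS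
  -- `L w` is a constant on `S`, nonnegative at a maximum and nonpositive at a minimum of `w`
  have hconst : ∀ j ∈ S, G.laplacian.mulVec w i = G.laplacian.mulVec w j := fun j hj =>
    eq_of_harmonicOn hS' (fun i _ => congrFun hw i) hiS hj
  obtain ⟨u, hu, hmax⟩ := S.exists_max_image w hS'.nonempty
  obtain ⟨v, hv, hmin⟩ := S.exists_min_image w hS'.nonempty
  apply le_antisymm
  · rw [hconst v hv, laplacian_mulVec]
    refine Finset.sum_nonpos fun j _ => ?_
    rcases (G.nonneg v j).eq_or_lt with h | h
    · simp [← h]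
    · have := hmin j (mem_of_reaches hS'.2 (.single h) hv)
      exact mul_nonpos_of_nonneg_of_nonpos h.le (by linarith)
  · rw [hconst u hu, laplacian_mulVec]
    refine Finset.sum_nonneg fun j _ => ?_
    rcases (G.nonneg u j).eq_or_lt with h | h
    · simp [← h]
    · have := hmax j (mem_of_reaches hS'.2 (.single h) hu)
      exact mul_nonneg h.le (by linarith)

theorem rootMultiplicity_laplacian (G : Network N) :
    G.laplacian.charpoly.rootMultiplicity 0 = G.basicBicomponents.card := by
  rw [Polynomial.rootMultiplicity_eq_natTrailingDegree', ← Matrix.charpoly_toLin',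
    ← LinearMap.finrank_maxGenEigenspace_zero_eq, ← G.finrank_ker_laplacian]
  suffices h : Module.End.maxGenEigenspace (Matrix.toLin' G.laplacian) 0
      = LinearMap.ker G.laplacian.mulVecLin by rw [h]
  ext w
  simp only [Module.End.mem_maxGenEigenspace, zero_smul, sub_zero, LinearMap.mem_ker,
    Matrix.mulVecLin_apply]
  constructor
  · rintro ⟨k, hk⟩
    induction k generalizing w with
    | zero =>
      obtain rfl : w = 0 := hk
      simp
    | succ k ih =>
      rw [pow_succ, Module.End.mul_apply, Matrix.toLin'_apply] at hk
      exact laplacian_mulVec_eq_zero (ih _ hk)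
  · exact fun h => ⟨1, by simpa using h⟩

end Network

/-! ### The closed loop as a linear system -/

section ClosedLoop

variable {N n m : ℕ}

theorem zeta_apply (G : Network N) (q : Fin N → ℝ) (M : Agent n) (x : Fin N → Fin n → ℝ)
    (i : Fin N) (k : Fin 1) :
    zeta G q M x i k
      = (1 + q i)⁻¹ * G.laplacian.mulVec (fun j => M.C.mulVec (x j) k) i := by
  rw [Network.laplacian_mulVec, Finset.mul_sum, zeta, Finset.sum_apply]
  rw [← Finset.sum_erase (a := i) Finset.univ (by simp)]
  refine Finset.sum_congr rfl fun j hj => ?_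
  have hij : i ≠ j := (Finset.ne_of_mem_erase hj).symm
  simp only [Network.rowStochastic, Matrix.of_apply, if_neg hij, Pi.smul_apply, Pi.sub_apply,
    smul_eq_mul]
  ring

/-- The information `ζ_i` as a linear function of the agent states. -/
noncomputable def zetaMap (G : Network N) (q : Fin N → ℝ) (M : Agent n) (i : Fin N) :
    (Fin N → Fin n → ℝ) →ₗ[ℝ] (Fin 1 → ℝ) where
  toFun x := zeta G q M x i
  map_add' x y := by
    rw [zeta, zeta, zeta, ← Finset.sum_add_distrib]
    refine Finset.sum_congr rfl fun j _ => ?_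
    rw [← smul_add, Pi.add_apply, Pi.add_apply, Matrix.mulVec_add, Matrix.mulVec_add]
    congr 1
    abel
  map_smul' c x := by
    rw [zeta, zeta, RingHom.id_apply, Finset.smul_sum]
    refine Finset.sum_congr rfl fun j _ => ?_
    rw [Pi.smul_apply, Pi.smul_apply, Matrix.mulVec_smul, Matrix.mulVec_smul, ← smul_sub,
      smul_comm]

/-- The update of an agent and its protocol, as a linear function of their joint state and of the
information that the agent receives. -/
noncomputable def nodeMap (M : Agent n) (P : Protocol m) :
    ((Fin n → ℝ) × (Fin m → ℝ)) × (Fin 1 → ℝ) →ₗ[ℝ] (Fin n → ℝ) × (Fin m → ℝ) where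
  toFun z := (M.A.mulVec z.1.1 + M.B.mulVec (P.Fc.mulVec z.1.2 + P.Gc.mulVec z.2),
    P.Ac.mulVec z.1.2 + P.Bc.mulVec z.2)
  map_add' z z' := by
    simp only [Prod.fst_add, Prod.snd_add, Matrix.mulVec_add, Prod.mk_add_mk]
    congr 1 <;> abel
  map_smul' c z := by
    simp only [Prod.smul_fst, Prod.smul_snd, Matrix.mulVec_smul, Prod.smul_mk, smul_add,
      Matrix.mulVec_add, RingHom.id_apply]

/-- The one-step map of the closed loop on the joint states of all agents and protocols. -/
noncomputable def stepMap (G : Network N) (q : Fin N → ℝ) (M : Agent n) (P : Protocol m) :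
    (Fin N → (Fin n → ℝ) × (Fin m → ℝ)) →ₗ[ℝ] (Fin N → (Fin n → ℝ) × (Fin m → ℝ)) :=
  LinearMap.pi fun i => nodeMap M P ∘ₗ (LinearMap.proj i).prod
    (zetaMap G q M i ∘ₗ LinearMap.pi fun j => LinearMap.fst ℝ _ _ ∘ₗ LinearMap.proj j)

theorem stepMap_apply (G : Network N) (q : Fin N → ℝ) (M : Agent n) (P : Protocol m)
    (z : Fin N → (Fin n → ℝ) × (Fin m → ℝ)) (i : Fin N) :
    stepMap G q M P z i = nodeMap M P (z i, zeta G q M (fun j => (z j).1) i) := rfl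

theorem isClosedLoop_iff {G : Network N} {q : Fin N → ℝ} {M : Agent n} {P : Protocol m}
    {ξ : ℕ → Fin N → (Fin n → ℝ) × (Fin m → ℝ)} :
    IsClosedLoop G q M P (fun t i => (ξ t i).1) (fun t i => (ξ t i).2) ↔
      ∀ t, ξ (t + 1) = stepMap G q M P (ξ t) :=
  forall_congr' fun _ => ⟨fun h => funext fun i => Prod.ext (h i).1 (h i).2,
    fun h i => ⟨congrArg Prod.fst (congrFun h i), congrArg Prod.snd (congrFun h i)⟩⟩

/-- Without incoming information, agent and protocol evolve by the matrix `Ã`. -/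
theorem sumElim_nodeMap (M : Agent n) (P : Protocol m) (v : (Fin n → ℝ) × (Fin m → ℝ)) :
    Sum.elim (nodeMap M P (v, 0)).1 (nodeMap M P (v, 0)).2
      = (tildeA M P).mulVec (Sum.elim v.1 v.2) := by
  simp [nodeMap, tildeA, Matrix.fromBlocks_mulVec, Matrix.mulVec_mulVec]

/-- Synchronization is robust: on a network with a directed spanning tree it persists under
disturbances of all agents and protocols that tend to zero. -/
theorem SolvesScaleFree.tendsto_of_perturbed {M : Agent n} {P : Protocol m}
    (hP : SolvesScaleFree M P) {G : Network N} {q : Fin N → ℝ} (hG : G.HasSpanningTree)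
    (hq : G.IsLocalBound q) {z e : ℕ → Fin N → (Fin n → ℝ) × (Fin m → ℝ)}
    (hz : ∀ t, z (t + 1) = stepMap G q M P (z t) + e t) (he : Tendsto e atTop (𝓝 0))
    (i j : Fin N) : Tendsto (fun t => (z t i).1 - (z t j).1) atTop (𝓝 0) := by
  let H : (Fin N → (Fin n → ℝ) × (Fin m → ℝ)) →ₗ[ℝ] (Fin n → ℝ) :=
    LinearMap.fst ℝ _ _ ∘ₗ LinearMap.proj i - LinearMap.fst ℝ _ _ ∘ₗ LinearMap.proj j
  refine tendsto_output_of_tendsto_input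
    (K := LinearMap.toContinuousLinearMap (stepMap G q M P))
    (H := LinearMap.toContinuousLinearMap H) (fun v => ?_) hz he
  refine hP N G q hG hq _ _ ((isClosedLoop_iff
    (ξ := fun t => (LinearMap.toContinuousLinearMap (stepMap G q M P) ^ t) v)).2 fun t => ?_) i j
  rw [pow_succ', mul_apply_eq_comp]
  rfl

/-- When the agent states tend to zero and the protocol is detectable through `B F_c`, the protocol
states tend to zero as well. -/
theorem tendsto_protocol_of_detectable {G : Network N} {q : Fin N → ℝ} {M : Agent n}
    {P : Protocol m} (hdet : Detectable (M.B * P.Fc) P.Ac)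
    {δ : ℕ → Fin N → (Fin n → ℝ) × (Fin m → ℝ)} (hδ : ∀ t, δ (t + 1) = stepMap G q M P (δ t))
    (hx : ∀ i, Tendsto (fun t => (δ t i).1) atTop (𝓝 0)) (i : Fin N) :
    Tendsto (fun t => (δ t i).2) atTop (𝓝 0) := by
  have hζ : Tendsto (fun t => zeta G q M (fun j => (δ t j).1) i) atTop (𝓝 0) := by
    have hc : Continuous (zetaMap G q M i) := LinearMap.continuous_of_finiteDimensional _
    have := (hc.tendsto 0).comp (tendsto_pi_nhds.2 hx)
    rwa [map_zero] at this
  have hlin : ∀ {k l : ℕ} (T : Matrix (Fin k) (Fin l) ℝ) {u : ℕ → Fin l → ℝ},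
      Tendsto u atTop (𝓝 0) → Tendsto (fun t => T.mulVec (u t)) atTop (𝓝 0) := by
    intro k l T u hu
    have hc : Continuous T.mulVecLin := LinearMap.continuous_of_finiteDimensional _
    have := (hc.tendsto 0).comp hu
    rwa [map_zero] at this
  refine tendsto_of_detectable (K := P.Ac.mulVecLin) (H := (M.B * P.Fc).mulVecLin)
    (e := fun t => P.Bc.mulVec (zeta G q M (fun j => (δ t j).1) i)) (fun v hv => ?_)
    (fun t => ?_) (hlin _ hζ) ?_
  · refine hdet (fun t => (P.Ac.mulVecLin ^ t) v) (fun t => ?_) hv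
    simp only [pow_succ', Module.End.mul_apply, Matrix.mulVecLin_apply]
  · exact congrArg Prod.snd (congrFun (hδ t) i)
  · -- the output `B F_c x_c` is what remains of the agent dynamics
    have h1 := (((hx i).comp (tendsto_add_atTop_nat 1)).sub (hlin M.A (hx i))).sub
      (hlin M.B (hlin P.Gc hζ))
    rw [sub_zero, sub_zero] at h1
    refine h1.congr fun t => ?_
    have h2 : (δ (t + 1) i).1 = M.A.mulVec (δ t i).1 + M.B.mulVec (P.Fc.mulVec (δ t i).2
        + P.Gc.mulVec (zeta G q M (fun j => (δ t j).1) i)) :=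
      congrArg Prod.fst (congrFun (hδ t) i)
    simp only [Function.comp_apply, h2, Matrix.mulVec_add, Matrix.mulVecLin_apply,
      Matrix.mulVec_mulVec]
    abel

end ClosedLoop

/-! ### Rewired networks -/

namespace Network

variable {N : ℕ}

open Classical in
/-- The network in which the nodes of `K` keep their incoming edges, and every other node receives
a single edge, from `r` and with weight one (`r` receives none unless it lies in `K`). -/
noncomputable def rewire (G : Network N) (K : Set (Fin N)) (r : Fin N) : Network N where
  a := Matrix.of fun i j => if i ∈ K then G.a i j else if j = r ∧ i ≠ r then 1 else 0
  nonneg i j := by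
    simp only [Matrix.of_apply]
    split_ifs
    · exact G.nonneg i j
    · exact zero_le_one
    · exact le_rfl
  no_loop i := by
    simp only [Matrix.of_apply]
    split_ifs with h₁ h₂
    · exact G.no_loop i
    · exact absurd h₂.1 h₂.2
    · rfl

open Classical in
/-- Local bounds for a rewired network. -/
noncomputable def rewireBound (q : Fin N → ℝ) (K : Set (Fin N)) (i : Fin N) : ℝ :=
  if i ∈ K then q i else 1

variable {G : Network N} {q : Fin N → ℝ} {K : Set (Fin N)} {r : Fin N}

theorem rewire_a_of_mem {i : Fin N} (hi : i ∈ K) (j : Fin N) : (G.rewire K r).a i j = G.a i j :=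
  if_pos hi

open Classical in
theorem rewire_a_of_notMem {i : Fin N} (hi : i ∉ K) (j : Fin N) :
    (G.rewire K r).a i j = if j = r ∧ i ≠ r then 1 else 0 :=
  if_neg hi

theorem isLocalBound_rewire (hq : G.IsLocalBound q) :
    (G.rewire K r).IsLocalBound (rewireBound q K) := by
  classical
  intro i
  by_cases hi : i ∈ K
  · simpa only [inDegree, rewire_a_of_mem hi, rewireBound, if_pos hi] using hq i
  · simp only [inDegree, rewire_a_of_notMem hi, rewireBound, if_neg hi]
    by_cases hir : i = r <;> simp [hir]

theorem hasSpanningTree_rewire (h : ∀ v ∈ K, ∃ u, (u ∉ K ∨ u = r) ∧ G.Reaches u v) :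
    (G.rewire K r).HasSpanningTree := by
  have hout : ∀ v, v ∉ K ∨ v = r → (G.rewire K r).Reaches r v := by
    intro v hv
    by_cases hvr : v = r
    · rw [hvr]
      exact .refl
    · refine .single ?_
      rw [Edge, rewire_a_of_notMem (hv.resolve_right hvr), if_pos ⟨rfl, hvr⟩]
      exact one_pos
  refine hasSpanningTree_of_reaches (r := r) fun v => ?_
  by_cases hv : v ∈ K
  · obtain ⟨u, hu, huv⟩ := h v hv
    clear hv
    induction huv with
    | refl => exact hout u hu
    | @tail b c _ hbc ih =>
      by_cases hc : c ∈ K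
      · refine ih.tail ?_
        rwa [Edge, rewire_a_of_mem hc]
      · exact hout c (.inl hc)
  · exact hout v (.inl hv)

variable {n : ℕ} {M : Agent n} {x : Fin N → Fin n → ℝ} {i : Fin N}

theorem zeta_rewire_of_mem (hi : i ∈ K) :
    zeta (G.rewire K r) (rewireBound q K) M x i = zeta G q M x i := by
  ext k
  simp only [zeta_apply, laplacian_mulVec, rewire_a_of_mem hi, rewireBound, if_pos hi]

theorem zeta_rewire_of_notMem (hi : i ∉ K) (h : x i = x r) :
    zeta (G.rewire K r) (rewireBound q K) M x i = 0 := by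
  ext k
  rw [zeta_apply, laplacian_mulVec, Pi.zero_apply]
  refine mul_eq_zero_of_right _ (Finset.sum_eq_zero fun j _ => ?_)
  rw [rewire_a_of_notMem hi]
  split_ifs with hj
  · rw [hj.1, h, sub_self, mul_zero]
  · exact zero_mul _

/-- The nodes of a set without incoming edges receive information from each other only. -/
theorem zeta_congr {S : Finset (Fin N)} (hS : ∀ u, u ∉ S → ∀ v ∈ S, ¬ G.Edge u v)
    {y : Fin N → Fin n → ℝ} (hxy : ∀ j ∈ S, x j = y j) (hi : i ∈ S) :
    zeta G q M x i = zeta G q M y i := by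
  ext k
  simp only [zeta_apply, laplacian_mulVec]
  congr 1
  refine Finset.sum_congr rfl fun j _ => ?_
  rcases (G.nonneg i j).eq_or_lt with h | h
  · rw [← h, zero_mul, zero_mul]
  · rw [hxy i hi, hxy j (mem_of_reaches hS (.single h) hi)]

end Network

/-! ### Synchronization on networks without a directed spanning tree -/

section Synchronization

variable {N n m : ℕ} {G : Network N} {q : Fin N → ℝ} {M : Agent n} {P : Protocol m}

/-- The agents of a basic bicomponent synchronize: the other nodes do not influence them, and may
be rewired so that the network has a directed spanning tree. -/
theorem SolvesScaleFree.tendsto_of_basicBicomponent (hP : SolvesScaleFree M P)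
    (hq : G.IsLocalBound q) {ξ : ℕ → Fin N → (Fin n → ℝ) × (Fin m → ℝ)}
    (hξ : ∀ t, ξ (t + 1) = stepMap G q M P (ξ t)) {S : Finset (Fin N)}
    (hS : G.IsBasicBicomponent S) {i j : Fin N} (hi : i ∈ S) (hj : j ∈ S) :
    Tendsto (fun t => (ξ t i).1 - (ξ t j).1) atTop (𝓝 0) := by
  let K : Set (Fin N) := {v | v ∈ S}
  let G' := G.rewire K i
  let q' := Network.rewireBound q K
  let η : ℕ → Fin N → (Fin n → ℝ) × (Fin m → ℝ) := fun t => (stepMap G' q' M P ^ t) (ξ 0)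
  have hη : ∀ t, η (t + 1) = stepMap G' q' M P (η t) := fun t => by
    simp only [η, pow_succ', Module.End.mul_apply]
  have heq : ∀ t, ∀ v ∈ S, η t v = ξ t v := by
    intro t
    induction t with
    | zero => exact fun v _ => rfl
    | succ t ih =>
      intro v hv
      rw [hη, hξ, stepMap_apply, stepMap_apply, ih v hv,
        Network.zeta_rewire_of_mem (show v ∈ K from hv),
        Network.zeta_congr hS.2 (fun u hu => congrArg Prod.fst (ih u hu)) hv]
  have htree : G'.HasSpanningTree :=
    Network.hasSpanningTree_rewire fun v hv => ⟨i, .inr rfl, hS.reaches hi hv⟩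
  refine (hP N G' q' htree (Network.isLocalBound_rewire hq) _ _
    (isClosedLoop_iff.2 hη) i j).congr fun t => ?_
  rw [heq t i hi, heq t j hj]

/-- If the agent states of the basic bicomponents tend to zero, then so do all agent states: up to
a vanishing disturbance, the remaining nodes behave as if the basic bicomponents were replaced by a
root at rest. -/
theorem SolvesScaleFree.tendsto_of_tendsto_basic (hP : SolvesScaleFree M P)
    (hq : G.IsLocalBound q) {δ : ℕ → Fin N → (Fin n → ℝ) × (Fin m → ℝ)}
    (hδ : ∀ t, δ (t + 1) = stepMap G q M P (δ t))
    (hbasic : ∀ i, G.IsBasic i → Tendsto (fun t => (δ t i).1) atTop (𝓝 0)) (i : Fin N) :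
    Tendsto (fun t => (δ t i).1) atTop (𝓝 0) := by
  classical
  by_cases hi : G.IsBasic i
  · exact hbasic i hi
  obtain ⟨R, hR, r, hrR, -⟩ := Network.exists_basicBicomponent_reaches (G := G) i
  have hr : G.IsBasic r := ⟨R, hR, hrR⟩
  let K : Set (Fin N) := {v | ¬ G.IsBasic v}
  let G' := G.rewire K r
  let q' := Network.rewireBound q K
  have htree : G'.HasSpanningTree := by
    refine Network.hasSpanningTree_rewire fun v _ => ?_
    obtain ⟨S, hS, u, hu, huv⟩ := Network.exists_basicBicomponent_reaches (G := G) v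
    exact ⟨u, .inl fun h => h ⟨S, hS, hu⟩, huv⟩
  let z : ℕ → Fin N → (Fin n → ℝ) × (Fin m → ℝ) := fun t v => if G.IsBasic v then 0 else δ t v
  have hz0 : ∀ t v, G.IsBasic v → z t v = 0 := fun t v hv => if_pos hv
  have hz1 : ∀ t v, ¬ G.IsBasic v → z t v = δ t v := fun t v hv => if_neg hv
  let e : ℕ → Fin N → (Fin n → ℝ) × (Fin m → ℝ) := fun t => z (t + 1) - stepMap G' q' M P (z t)
  have hδz : Tendsto (fun t v => (δ t v).1 - (z t v).1) atTop (𝓝 0) := by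
    refine tendsto_pi_nhds.2 fun v => ?_
    by_cases hv : G.IsBasic v
    · simpa only [hz0 _ v hv, Prod.fst_zero, sub_zero, Pi.zero_apply] using hbasic v hv
    · simp only [hz1 _ v hv, sub_self]
      exact tendsto_const_nhds
  have he : Tendsto e atTop (𝓝 0) := by
    refine tendsto_pi_nhds.2 fun v => ?_
    by_cases hv : G.IsBasic v
    · refine tendsto_const_nhds.congr fun t => ?_
      have hvK : v ∉ K := fun h => h hv
      change _ = z (t + 1) v - stepMap G' q' M P (z t) v
      rw [stepMap_apply, Network.zeta_rewire_of_notMem hvK (by rw [hz0 t v hv, hz0 t r hr]),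
        hz0 _ v hv, hz0 _ v hv, Prod.mk_zero_zero, map_zero, sub_zero, Pi.zero_apply]
    · let T : (Fin N → Fin n → ℝ) →ₗ[ℝ] (Fin n → ℝ) × (Fin m → ℝ) :=
        nodeMap M P ∘ₗ LinearMap.inr ℝ _ _ ∘ₗ zetaMap G q M v
      have hc : Continuous T := T.continuous_of_finiteDimensional
      have hT := (hc.tendsto 0).comp hδz
      rw [map_zero] at hT
      refine hT.congr fun t => ?_
      have hvK : v ∈ K := hv
      change nodeMap M P (0, zetaMap G q M v ((fun u => (δ t u).1) - fun u => (z t u).1))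
        = z (t + 1) v - stepMap G' q' M P (z t) v
      rw [stepMap_apply, Network.zeta_rewire_of_mem hvK, hz1 _ v hv, hz1 _ v hv, hδ, stepMap_apply,
        ← map_sub, Prod.mk_sub_mk, sub_self, map_sub]
      rfl
  refine (hP.tendsto_of_perturbed htree (Network.isLocalBound_rewire hq) (z := z) (e := e)
    (fun t => by simp only [e]; abel) he i r).congr fun t => ?_
  rw [hz1 t i hi, hz0 t r hr, Prod.fst_zero, sub_zero]

/-- A normalized left null vector of the rows of `I - D` that belong to a basic bicomponent. It
exists because the constant one is not in the range of these rows, by the maximum principle. -/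
theorem exists_left_null (hq : G.IsLocalBound q) {S : Finset (Fin N)}
    (hS : G.IsBasicBicomponent S) :
    ∃ α : Fin N → ℝ, ∑ i ∈ S, α i = 1 ∧
      ∀ w, ∑ i ∈ S, α i * ((1 + q i)⁻¹ * G.laplacian.mulVec w i) = 0 := by
  classical
  let Ψ : (Fin N → ℝ) →ₗ[ℝ] (S → ℝ) :=
    LinearMap.pi fun i => (1 + q i)⁻¹ • (LinearMap.proj (i : Fin N) ∘ₗ G.laplacian.mulVecLin)
  have hΨ : ∀ w i, Ψ w i = (1 + q i)⁻¹ * G.laplacian.mulVec w i := fun w i => rfl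
  have hone : (1 : S → ℝ) ∉ LinearMap.range Ψ := by
    rintro ⟨w, hw⟩
    obtain ⟨c, hc, hmin⟩ := S.exists_min_image w hS.nonempty
    have h1 := congrFun hw ⟨c, hc⟩
    rw [hΨ, Network.laplacian_mulVec, Pi.one_apply] at h1
    have hqc : 0 ≤ q c := (Finset.sum_nonneg fun j _ => G.nonneg c j).trans (hq c)
    have h2 : ∑ j, G.a c j * (w c - w j) ≤ 0 := by
      refine Finset.sum_nonpos fun j _ => ?_
      rcases (G.nonneg c j).eq_or_lt with h | h
      · rw [← h, zero_mul]
      · have := hmin j (Network.mem_of_reaches hS.2 (.single h) hc)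
        exact mul_nonpos_of_nonneg_of_nonpos h.le (by linarith)
    have h3 := mul_nonpos_of_nonneg_of_nonpos (inv_nonneg.2 (by linarith : 0 ≤ 1 + q c)) h2
    simp only at h1
    linarith
  obtain ⟨f, hf1, hf⟩ := Submodule.exists_le_ker_of_notMem hone
  have hsum : ∀ v : S → ℝ, f v = ∑ i, v i * f (Pi.single i 1) := by
    intro v
    conv_lhs => rw [pi_eq_sum_univ' v]
    simp [map_sum]
  refine ⟨fun i => if h : i ∈ S then (f 1)⁻¹ * f (Pi.single ⟨i, h⟩ 1) else 0, ?_, fun w => ?_⟩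
  · rw [← Finset.sum_coe_sort]
    simp only [Finset.coe_mem, dif_pos, Subtype.coe_eta]
    rw [← Finset.mul_sum]
    have := hsum 1
    simp only [Pi.one_apply, one_mul] at this
    rw [← this, inv_mul_cancel₀ hf1]
  · rw [← Finset.sum_coe_sort]
    simp only [Finset.coe_mem, dif_pos, Subtype.coe_eta]
    have h0 : f (Ψ w) = 0 := hf ⟨w, rfl⟩
    rw [hsum] at h0
    simp only [hΨ] at h0
    calc _ = (f 1)⁻¹ * ∑ i : S, (1 + q i)⁻¹ * G.laplacian.mulVec w i * f (Pi.single i 1) := by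
          rw [Finset.mul_sum]
          exact Finset.sum_congr rfl fun i _ => by ring
      _ = 0 := by rw [h0, mul_zero]

/-- Weighting the states of a basic bicomponent with a left null vector cancels the information
exchange. -/
theorem sum_smul_stepMap {S : Finset (Fin N)} {α : Fin N → ℝ}
    (hα : ∀ w, ∑ i ∈ S, α i * ((1 + q i)⁻¹ * G.laplacian.mulVec w i) = 0)
    (z : Fin N → (Fin n → ℝ) × (Fin m → ℝ)) :
    ∑ i ∈ S, α i • stepMap G q M P z i = nodeMap M P (∑ i ∈ S, α i • z i, 0) := by
  have hζ : ∑ i ∈ S, α i • zeta G q M (fun j => (z j).1) i = 0 := by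
    ext k
    simpa only [Finset.sum_apply, Pi.smul_apply, smul_eq_mul, zeta_apply, Pi.zero_apply] using hα _
  simp only [stepMap_apply, ← map_smul, ← map_sum]
  congr 1
  refine Prod.ext ?_ ?_
  · simp [Prod.fst_sum]
  · simpa [Prod.snd_sum] using hζ

/-- States proportional to a function in the kernel of the Laplacian exchange no information. -/
theorem stepMap_smul_of_harmonic {b : Fin N → ℝ} (hb : G.laplacian.mulVec b = 0)
    (v : (Fin n → ℝ) × (Fin m → ℝ)) :
    stepMap G q M P (fun j => b j • v) = fun j => b j • nodeMap M P (v, 0) := by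
  funext j
  have hζ : zeta G q M (fun j => (b j • v).1) j = 0 := by
    ext k
    have : (fun j => M.C.mulVec (b j • v).1 k) = M.C.mulVec v.1 k • b := by
      funext j
      simp [Matrix.mulVec_smul, mul_comm]
    rw [zeta_apply, this, Matrix.mulVec_smul, hb, smul_zero, Pi.zero_apply, mul_zero,
      Pi.zero_apply]
  rw [stepMap_apply, hζ, ← map_smul, Prod.smul_mk (b j) v (0 : Fin 1 → ℝ), smul_zero]

end Synchronization

end ScaleFree

theorem theorem4 {N : ℕ} (hN : 0 < N) (G : ScaleFree.Network N) (hG : ¬ G.HasSpanningTree) :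
    -- the Laplacian has the eigenvalue zero with multiplicity `k > 1`,
    -- and `k` is the number of basic bicomponents
    1 < G.basicBicomponents.card ∧
    G.laplacian.charpoly.rootMultiplicity 0 = G.basicBicomponents.card ∧
    -- the weights depend on the network alone
    ∃ β : Fin N → Finset (Fin N) → ℝ,
      (∀ j, (∀ S ∈ G.basicBicomponents, j ∉ S) →
        (∀ S ∈ G.basicBicomponents, 0 ≤ β j S) ∧ ∑ S ∈ G.basicBicomponents, β j S = 1) ∧
      ∀ q : Fin N → ℝ, G.IsLocalBound q →
        -- the coefficients in the initial conditions of the synchronized trajectories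
        ∃ α : Finset (Fin N) → Fin N → ℝ,
          ∀ (n m : ℕ) (M : ScaleFree.Agent n) (P : ScaleFree.Protocol m),
            ScaleFree.SolvesScaleFree M P →
            ∀ (x : ℕ → Fin N → Fin n → ℝ) (xc : ℕ → Fin N → Fin m → ℝ),
              ScaleFree.IsClosedLoop G q M P x xc →
              ∃ (xs : Finset (Fin N) → ℕ → Fin n → ℝ) (xsc : Finset (Fin N) → ℕ → Fin m → ℝ),
                -- the synchronized trajectories of the basic bicomponents
                (∀ S ∈ G.basicBicomponents,
                  (∀ t, Sum.elim (xs S (t + 1)) (xsc S (t + 1)) =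
                    (ScaleFree.tildeA M P).mulVec (Sum.elim (xs S t) (xsc S t))) ∧
                  Sum.elim (xs S 0) (xsc S 0) = ∑ j ∈ S, α S j • Sum.elim (x 0 j) (xc 0 j)) ∧
                -- agent states
                (∀ S ∈ G.basicBicomponents, ∀ j ∈ S,
                  Tendsto (fun t => x t j - xs S t) atTop (𝓝 0)) ∧
                (∀ j, (∀ S ∈ G.basicBicomponents, j ∉ S) →
                  Tendsto (fun t => x t j - ∑ S ∈ G.basicBicomponents, β j S • xs S t)
                    atTop (𝓝 0)) ∧
                -- protocol states, when no unstable protocol mode is hidden from the agents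
                (ScaleFree.Detectable (M.B * P.Fc) P.Ac →
                  (∀ S ∈ G.basicBicomponents, ∀ j ∈ S,
                    Tendsto (fun t => xc t j - xsc S t) atTop (𝓝 0)) ∧
                  (∀ j, (∀ S ∈ G.basicBicomponents, j ∉ S) →
                    Tendsto (fun t => xc t j - ∑ S ∈ G.basicBicomponents, β j S • xsc S t)
                      atTop (𝓝 0))) := by
  classical
  refine ⟨ScaleFree.Network.one_lt_card_basicBicomponents hN hG, G.rootMultiplicity_laplacian, ?_⟩
  obtain ⟨β, hker, hval, hnonneg, hsum⟩ := G.exists_harmonicMeasure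
  refine ⟨β, fun j _ => ⟨hnonneg j, hsum j⟩, fun q hq => ?_⟩
  have hα : ∀ S, ∃ α : Fin N → ℝ, S ∈ G.basicBicomponents → ∑ i ∈ S, α i = 1 ∧
      ∀ w, ∑ i ∈ S, α i * ((1 + q i)⁻¹ * G.laplacian.mulVec w i) = 0 := by
    intro S
    by_cases hS : S ∈ G.basicBicomponents
    · obtain ⟨α, h⟩ :=
        ScaleFree.exists_left_null hq (ScaleFree.Network.mem_basicBicomponents.1 hS)
      exact ⟨α, fun _ => h⟩
    · exact ⟨0, fun h => absurd h hS⟩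
  choose α hα using hα
  refine ⟨α, fun n m M P hP x xc hloop => ?_⟩
  let ξ : ℕ → Fin N → (Fin n → ℝ) × (Fin m → ℝ) := fun t i => (x t i, xc t i)
  have hξ : ∀ t, ξ (t + 1) = ScaleFree.stepMap G q M P (ξ t) :=
    ScaleFree.isClosedLoop_iff.1 hloop
  -- the synchronized trajectories
  let Ξ : Finset (Fin N) → ℕ → (Fin n → ℝ) × (Fin m → ℝ) := fun S t => ∑ i ∈ S, α S i • ξ t i
  have hΞ : ∀ S ∈ G.basicBicomponents, ∀ t,
      Ξ S (t + 1) = ScaleFree.nodeMap M P (Ξ S t, 0) := by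
    intro S hS t
    rw [← ScaleFree.sum_smul_stepMap (hα S hS).2 (ξ t), ← hξ]
  -- the deviations from the interpolated synchronized trajectories solve the closed loop
  let δ : ℕ → Fin N → (Fin n → ℝ) × (Fin m → ℝ) := fun t =>
    ξ t - ∑ S ∈ G.basicBicomponents, fun j => β j S • Ξ S t
  have hδ : ∀ t, δ (t + 1) = ScaleFree.stepMap G q M P (δ t) := by
    intro t
    simp only [δ, map_sub, map_sum, hξ]
    congr 1
    refine Finset.sum_congr rfl fun S hS => ?_
    rw [ScaleFree.stepMap_smul_of_harmonic (hker S hS), hΞ S hS]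
  have hδ1 : ∀ t j, (δ t j).1 = x t j - ∑ S ∈ G.basicBicomponents, β j S • (Ξ S t).1 := by
    intro t j
    simp [δ, ξ, Prod.fst_sum]
  have hδ2 : ∀ t j, (δ t j).2 = xc t j - ∑ S ∈ G.basicBicomponents, β j S • (Ξ S t).2 := by
    intro t j
    simp [δ, ξ, Prod.snd_sum]
  have hcollapse : ∀ T ∈ G.basicBicomponents, ∀ j ∈ T, ∀ {k : ℕ} (g : Finset (Fin N) → Fin k → ℝ),
      ∑ S ∈ G.basicBicomponents, β j S • g S = g T := by
    intro T hT j hj k g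
    rw [Finset.sum_congr rfl fun S hS => by rw [hval S hS T hT j hj]]
    simp [hT]
  have hx : ∀ j, Tendsto (fun t => (δ t j).1) atTop (𝓝 0) := by
    refine hP.tendsto_of_tendsto_basic hq hδ ?_
    rintro j ⟨T, hT, hj⟩
    have h1 : Tendsto (fun t => ∑ i ∈ T, α T i • (x t j - x t i)) atTop
        (𝓝 (∑ i ∈ T, α T i • (0 : Fin n → ℝ))) :=
      tendsto_finsetSum _ fun i hi => (hP.tendsto_of_basicBicomponent hq hξ
        (ScaleFree.Network.mem_basicBicomponents.1 hT) hj hi).const_smul _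
    simp only [smul_zero, Finset.sum_const_zero] at h1
    refine h1.congr fun t => ?_
    rw [hδ1, hcollapse T hT j hj]
    simp only [smul_sub, Finset.sum_sub_distrib, ← Finset.sum_smul, (hα T hT).1, one_smul, Ξ, ξ,
      Prod.fst_sum, Prod.smul_fst]
  refine ⟨fun S t => (Ξ S t).1, fun S t => (Ξ S t).2, fun S hS => ⟨fun t => ?_, ?_⟩,
    fun S hS j hj => ?_, fun j _ => ?_, fun hdet => ?_⟩
  · exact (congrArg (fun v => Sum.elim v.1 v.2) (hΞ S hS t)).trans
      (ScaleFree.sumElim_nodeMap M P (Ξ S t))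
  · ext (k | k) <;> simp [Ξ, ξ, Prod.fst_sum, Prod.snd_sum]
  · exact (hx j).congr fun t => by rw [hδ1, hcollapse S hS j hj]
  · exact (hx j).congr fun t => hδ1 t j
  · have hxc := ScaleFree.tendsto_protocol_of_detectable hdet hδ hx
    exact ⟨fun S hS j hj => (hxc j).congr fun t => by rw [hδ2, hcollapse S hS j hj],
      fun j _ => (hxc j).congr fun t => hδ2 t j⟩
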